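/- Let $K$ be a field of characteristic $0$ and let $z,u$ and $X=(X_1,X_2,X_3,\ldots)$ be independent indeterminates over $K$. For a partition $\mu$, let $|\mu|$ be its weight, $l(\mu)$ its length, $m_i(\mu)$ the multiplicity of the part $i$ in $\mu$, and $z_\mu=\prod_{i\ge1} i^{m_i(\mu)}\,m_i(\mu)!$. For an integer $r\ge 0$, let $\left\langle{\mu\atop r}\right\rangle$ be the number of ways to choose $r$ cells in the Ferrers diagram of $\mu$ such that at least one cell is chosen in each row (so it is $1$ for $\mu=\emptyset$, $r=0$). For integers $j,k\ge0$ put $$P_{jk}(X)=\sum_{|\mu|=j}\frac{\left\langle{\mu\atop k}\right\rangle}{z_\mu}\prod_{i\ge1}X_i^{m_i(\mu)},$$ the sum being over all partitions $\mu$ of $j$; in particular $P_{00}(X)=1$. Put $(i)_k=i(i+1)\cdots(i+k-1)$ and, for a polynomial $a$ and an integer $m\ge0$, $\binom{a}{m}=a(a-1)\cdots(a-m+1)/m!$; for integers $a\ge 0$ and $m<0$ put $\binom{a}{m}=0$. Then for all integers $n,r\ge1$ the following identity of formal power series in $u$ with coefficients in $K[z,X_1,X_2,\ldots]$ holds: $$\sum_{|\mu|=n}(-1)^{r-l(\mu)}\,\frac{\left\langle{\mu\atop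 r}\right\rangle}{z_\mu}\prod_{i\ge1}\Bigl(z+\sum_{k\ge1}u^k\,\frac{(i)_k}{k!}\,X_k\Bigr)^{m_i(\mu)}=\sum_{j\ge0}u^j\binom{n+j-1}{n-r}\left(\sum_{k=0}^{\min(r,j)}\binom{z-j}{r-k}P_{jk}(X)\right).$$ -/

import Mathlib

open scoped Nat PowerSeries

namespace PartitionIdentity

/-- The parts of a partition `μ`, in decreasing order. -/
def rows {n : ℕ} (μ : n.Partition) : List ℕ := μ.parts.sort (· ≥ ·)

/-- The Ferrers diagram of `μ`: the cells `(i, j)` where `i` is (the index of) a row of `μ`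
and `j` is one of the `μ_i` positions in this row. -/
abbrev Cell {n : ℕ} (μ : n.Partition) : Type :=
  (i : Fin (rows μ).length) × Fin ((rows μ).get i)

/-- The generalized binomial coefficient `⟨μ r⟩`: the number of ways to choose `r` cells in the
diagram of `μ` so that at least one cell is chosen in each row. -/
def bracket {n : ℕ} (μ : n.Partition) (r : ℕ) : ℕ :=
  Fintype.card {S : Finset (Cell μ) // S.card = r ∧ ∀ i, ∃ j, (⟨i, j⟩ : Cell μ) ∈ S}

/-- The length `l(μ)`. -/
def len {n : ℕ} (μ : n.Partition) : ℕ := μ.parts.card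

/-- The multiplicity `m_i(μ)` of `i` in `μ`. -/
def mult {n : ℕ} (μ : n.Partition) (i : ℕ) : ℕ := μ.parts.count i

/-- `z_μ = ∏_{i ≥ 1} i ^ m_i(μ) * m_i(μ)!`; the factors with `i > n` are equal to `1`. -/
def zee {n : ℕ} (μ : n.Partition) : ℕ :=
  ∏ i ∈ Finset.Icc 1 n, i ^ mult μ i * (mult μ i)!

/-- The binomial coefficient `a (a - 1) ⋯ (a - m + 1) / m!` of an element of a `K`-algebra. -/
noncomputable def binom (K : Type*) [Field K] {A : Type*} [CommRing A] [Algebra K A]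
    (a : A) (m : ℕ) : A :=
  ((m ! : K)⁻¹) • ∏ i ∈ Finset.range m, (a - (i : A))

/-- `P_{jk}(X) = ∑_{|μ| = j} ⟨μ k⟩ / z_μ * ∏_{i ≥ 1} X_i ^ m_i(μ)`.  The indeterminate `X_i` is
`MvPolynomial.X i` with `i ≥ 1`; the variable of index `0` does not occur. -/
noncomputable def P (K : Type*) [Field K] (j k : ℕ) : MvPolynomial ℕ K :=
  ∑ μ : j.Partition, ((bracket μ k : K) / (zee μ : K)) •
    ∏ i ∈ Finset.Icc 1 j, (MvPolynomial.X i : MvPolynomial ℕ K) ^ mult μ i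

/-- The ring of polynomials in `X_1, X_2, …` and `z` over `K`; the indeterminate `u` is the
variable of the power series ring `(Coeff K)⟦X⟧`. -/
abbrev Coeff (K : Type*) [Field K] : Type _ := Polynomial (MvPolynomial ℕ K)

/-- The indeterminate `z`. -/
noncomputable def zVar (K : Type*) [Field K] : Coeff K := Polynomial.X

/-- The indeterminate `X_k` (for `k ≥ 1`). -/
noncomputable def xVar (K : Type*) [Field K] (k : ℕ) : Coeff K :=
  Polynomial.C (MvPolynomial.X k)

/-- The formal power series `z + ∑_{k ≥ 1} u ^ k * (i)_k / k! * X_k` in `u`, where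
`(i)_k = i (i + 1) ⋯ (i + k - 1)`. -/
noncomputable def rowSeries (K : Type*) [Field K] (i : ℕ) : (Coeff K)⟦X⟧ :=
  PowerSeries.C (zVar K) + PowerSeries.mk fun k =>
    if 1 ≤ k then ((i.ascFactorial k : K) / (k ! : K)) • xVar K k else 0

/-- The usual binomial coefficient `C(a, b - c)`, which is zero when `b - c` is negative. -/
def natBinom (a b c : ℕ) : ℕ := if c ≤ b then a.choose (b - c) else 0

end PartitionIdentity

/-!
Put `E(a)(q) = exp (∑ i, a i * q ^ i / i) = ∑ n, h_n(a) * q ^ n`, so that `E(a + b) = E(a) * E(b)`.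
The brackets of `μ` have generating polynomial `∏ i, ((1 + t) ^ μ_i - 1)`, hence
`∑_{|μ| = n} ⟨μ r⟩ / z_μ * a_μ = ∑_{p + s = n} C(p, r) * h_p(a) * h_s(-a)` for every sequence `a`.

Let `x = (z, X 1, X 2, …)` and `c i = z + ∑ k ≥ 1, u ^ k * (i)_k / k! * X k`. Then
`E(x)(u) * E(c)(q) = ∑ j, u ^ j * h_j(x) * (1 - q) ^ (-(z + j))`: as series in `q`, both sides solve
`F' = (∑ i, c (i + 1) * q ^ i) * F` with the same initial value. Since `E(x) * E(-x) = 1`, this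
makes the products `h_p(-c) * h_s(c)` explicit. In the coefficient of `u ^ j`, Vandermonde's
identity in `p` produces `C(n + j - 1, n - r)`, and the remaining sum is the same bracket sum for
`x` after expanding `C(z - s, r) = C((z - j) + (j - s), r)` by Vandermonde once more.
-/

namespace PartitionIdentity

open Finset

section Partition

variable {n : ℕ} (μ : n.Partition)

theorem mult_eq_zero_of_notMem_Icc {i : ℕ} (hi : i ∉ Icc 1 n) : mult μ i = 0 :=
  Multiset.count_eq_zero_of_notMem fun h =>
    hi (mem_Icc.2 ⟨μ.parts_pos h, μ.le_of_mem_parts h⟩)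

@[to_additive]
theorem prod_pow_mult {A : Type*} [CommMonoid A] (a : ℕ → A) :
    ∏ i ∈ Icc 1 n, a i ^ mult μ i = (μ.parts.map a).prod := by
  rw [prod_multiset_map_count]
  refine (prod_subset (fun i hi => ?_) fun i _ hi => ?_).symm
  · have hi := Multiset.mem_toFinset.1 hi
    exact mem_Icc.2 ⟨μ.parts_pos hi, μ.le_of_mem_parts hi⟩
  · rw [mult, Multiset.count_eq_zero.2 (Multiset.mem_toFinset.not.1 hi), pow_zero]

theorem sum_mul_mult : ∑ i ∈ Icc 1 n, i * mult μ i = n := by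
  have h := sum_nsmul_mult μ id
  rw [Multiset.map_id, μ.parts_sum] at h
  simpa only [smul_eq_mul, id, mul_comm] using h

theorem zee_eq_prod_Icc {N : ℕ} (hN : n ≤ N) :
    zee μ = ∏ i ∈ Icc 1 N, i ^ mult μ i * (mult μ i)! := by
  refine prod_subset (Icc_subset_Icc_right hN) fun i _ hi => ?_
  rw [mult_eq_zero_of_notMem_Icc μ hi, pow_zero, Nat.factorial_zero, one_mul]

theorem zee_ne_zero : zee μ ≠ 0 :=
  prod_ne_zero_iff.2 fun _ hi => mul_ne_zero
    (pow_ne_zero _ (Nat.one_le_iff_ne_zero.1 (mem_Icc.1 hi).1)) (Nat.factorial_ne_zero _)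

theorem zee_of_parts_eq_cons {m i : ℕ} (ν : m.Partition) (h : μ.parts = i ::ₘ ν.parts) :
    zee μ = i * mult μ i * zee ν := by
  have hi : i ∈ μ.parts := h ▸ Multiset.mem_cons_self i _
  have hmult (k : ℕ) : mult μ k = mult ν k + if k = i then 1 else 0 := by
    rw [mult, mult, h, Multiset.count_cons]
  have hm : m ≤ n := by
    have := congrArg Multiset.sum h
    rw [Multiset.sum_cons, μ.parts_sum, ν.parts_sum] at this
    lia
  have hi' : i ∈ Icc 1 n := mem_Icc.2 ⟨μ.parts_pos hi, μ.le_of_mem_parts hi⟩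
  rw [zee, zee_eq_prod_Icc ν hm, ← mul_prod_erase _ _ hi', ← mul_prod_erase _ _ hi', ← mul_assoc]
  congr 1
  · rw [hmult, if_pos rfl, pow_succ, Nat.factorial_succ]
    ring
  · refine prod_congr rfl fun k hk => ?_
    rw [hmult, if_neg (ne_of_mem_erase hk), add_zero]

end Partition

section Exponential

open PowerSeries

theorem eq_C_constantCoeff_of_derivative_eq_zero {A : Type*} [CommRing A] [IsAddTorsionFree A]
    {f : A⟦X⟧} (hf : d⁄dX A f = 0) : f = C (constantCoeff f) :=
  derivative.ext (by rw [hf, derivative_C]) (by simp)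

variable (K : Type*) [Field K] {A B : Type*} [CommRing A] [Algebra K A] [CommRing B] [Algebra K B]

/-- The coefficient of `q ^ n` in `exp (∑ i, a i * q ^ i / i)`, that is, the complete homogeneous
symmetric function `h n` as a polynomial in the power sums `a 1, a 2, …`.  The term `a 0` does not
occur. -/
noncomputable def expCoeff (a : ℕ → A) (n : ℕ) : A :=
  ∑ μ : n.Partition, (zee μ : K)⁻¹ • (μ.parts.map a).prod

/-- The generating series `exp (∑ i, a i * q ^ i / i)` of the coefficients `expCoeff`. -/
noncomputable def expSeries (a : ℕ → A) : A⟦X⟧ := mk (expCoeff K a)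

theorem coeff_expSeries (a : ℕ → A) (n : ℕ) : coeff n (expSeries K a) = expCoeff K a n :=
  coeff_mk _ _

theorem expCoeff_zero (a : ℕ → A) : expCoeff K a 0 = 1 := by
  simp [expCoeff, zee]

theorem map_expCoeff (f : A →ₐ[K] B) (a : ℕ → A) (n : ℕ) :
    f (expCoeff K a n) = expCoeff K (fun i => f (a i)) n := by
  simp only [expCoeff, map_sum, map_smul, map_multiset_prod, Multiset.map_map, Function.comp_def]

theorem expCoeff_pow_mul (w : A) (a : ℕ → A) (n : ℕ) :
    expCoeff K (fun i => w ^ i * a i) n = w ^ n * expCoeff K a n := by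
  rw [expCoeff, expCoeff, mul_sum]
  refine sum_congr rfl fun μ _ => ?_
  have hw : (μ.parts.map (w ^ ·)).prod = w ^ n := by
    rw [← prod_pow_mult]
    simp only [← pow_mul]
    rw [prod_pow_eq_pow_sum, sum_mul_mult]
  rw [Multiset.prod_map_mul, hw, mul_smul_comm]

theorem constantCoeff_expSeries (a : ℕ → A) : constantCoeff (expSeries K a) = 1 := by
  rw [← coeff_zero_eq_constantCoeff_apply, coeff_expSeries, expCoeff_zero]

variable [CharZero K]

theorem sum_mult_smul_prod_parts (a : ℕ → A) {n i : ℕ} (hi : 1 ≤ i) (hin : i ≤ n) :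
    ∑ μ : n.Partition, ((i * mult μ i : ℕ) * (zee μ : K)⁻¹) • (μ.parts.map a).prod =
      a i * expCoeff K a (n - i) := by
  have hsupp (μ : n.Partition)
      (hμ : ((i * mult μ i : ℕ) * (zee μ : K)⁻¹) • (μ.parts.map a).prod ≠ 0) : i ∈ μ.parts := by
    by_contra h
    simp [mult, h] at hμ
  rw [expCoeff, mul_sum, ← sum_filter_of_ne fun μ _ => hsupp μ,
    sum_subtype (p := fun μ => i ∈ μ.parts) _ (by simp)]
  refine Fintype.sum_equiv (Nat.Partition.partitionWithPartEquiv hi hin) _ _ fun ⟨μ, hμ⟩ => ?_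
  set ν := Nat.Partition.partitionWithPartEquiv hi hin ⟨μ, hμ⟩ with hν
  have hparts : μ.parts = i ::ₘ ν.parts := by
    rw [hν, Nat.Partition.partitionWithPartEquiv_apply_parts, Multiset.cons_erase hμ]
  have hne : ((i * mult μ i : ℕ) : K) ≠ 0 := Nat.cast_ne_zero.2
    (left_ne_zero_of_mul (zee_of_parts_eq_cons μ ν hparts ▸ zee_ne_zero μ))
  rw [zee_of_parts_eq_cons μ ν hparts, hparts, Multiset.map_cons, Multiset.prod_cons,
    mul_smul_comm, Nat.cast_mul _ (zee ν), mul_inv, mul_inv_cancel_left₀ hne]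

theorem succ_mul_expCoeff_succ (a : ℕ → A) (n : ℕ) :
    (n + 1) * expCoeff K a (n + 1) =
      ∑ p ∈ antidiagonal n, a (p.1 + 1) * expCoeff K a p.2 := by
  have hsplit (μ : (n + 1).Partition) :
      ((n : A) + 1) * ((zee μ : K)⁻¹ • (μ.parts.map a).prod) =
        ∑ i ∈ Icc 1 (n + 1), ((i * mult μ i : ℕ) * (zee μ : K)⁻¹) • (μ.parts.map a).prod := by
    rw [← sum_smul, ← sum_mul, ← Nat.cast_sum, sum_mul_mult, mul_smul, Nat.cast_smul_eq_nsmul,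
      nsmul_eq_mul, Nat.cast_succ]
  calc (n + 1) * expCoeff K a (n + 1)
      = ∑ i ∈ Icc 1 (n + 1), a i * expCoeff K a (n + 1 - i) := by
        rw [expCoeff, mul_sum, sum_congr rfl fun μ _ => hsplit μ, sum_comm]
        exact sum_congr rfl fun i hi =>
          sum_mult_smul_prod_parts K a (mem_Icc.1 hi).1 (mem_Icc.1 hi).2
    _ = ∑ p ∈ antidiagonal n, a (p.1 + 1) * expCoeff K a p.2 := by
        rw [Nat.sum_antidiagonal_eq_sum_range_succ fun i j => a (i + 1) * expCoeff K a j,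
          ← Ico_add_one_right_eq_Icc, range_eq_Ico,
          ← sum_Ico_add' (fun i => a i * expCoeff K a (n + 1 - i)) 0 (n + 1) 1]
        simp only [Nat.add_sub_add_right, Nat.succ_eq_add_one]

theorem derivative_expSeries (a : ℕ → A) :
    d⁄dX A (expSeries K a) = mk (fun i => a (i + 1)) * expSeries K a := by
  ext n
  rw [coeff_derivative, coeff_expSeries, coeff_mul, mul_comm, succ_mul_expCoeff_succ]
  simp only [coeff_mk, coeff_expSeries]

theorem derivative_mul_expSeries_neg {a : ℕ → A} {f : A⟦X⟧}
    (hf : d⁄dX A f = mk (fun i => a (i + 1)) * f) : d⁄dX A (f * expSeries K (-a)) = 0 := by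
  have hneg : mk (fun i => (-a) (i + 1)) = -mk (fun i => a (i + 1)) := rfl
  rw [Derivation.leibniz, derivative_expSeries, hf, hneg, smul_eq_mul, smul_eq_mul]
  ring

theorem expSeries_mul_expSeries_neg (a : ℕ → A) : expSeries K a * expSeries K (-a) = 1 := by
  have := IsAddTorsionFree.of_isTorsionFree K A
  rw [eq_C_constantCoeff_of_derivative_eq_zero
      (derivative_mul_expSeries_neg K (derivative_expSeries K a)),
    map_mul, constantCoeff_expSeries, constantCoeff_expSeries, one_mul, map_one]

theorem eq_C_mul_expSeries {a : ℕ → A} {f : A⟦X⟧} (hf : d⁄dX A f = mk (fun i => a (i + 1)) * f) :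
    f = C (constantCoeff f) * expSeries K a := by
  have := IsAddTorsionFree.of_isTorsionFree K A
  have hconst := eq_C_constantCoeff_of_derivative_eq_zero (derivative_mul_expSeries_neg K hf)
  rw [map_mul, constantCoeff_expSeries, mul_one] at hconst
  rw [← hconst, mul_assoc, mul_comm (expSeries K (-a)), expSeries_mul_expSeries_neg, mul_one]

theorem expSeries_add (a b : ℕ → A) : expSeries K (a + b) = expSeries K a * expSeries K b := by
  have hadd : mk (fun i => (a + b) (i + 1)) = mk (fun i => a (i + 1)) + mk fun i => b (i + 1) := rfl
  have h := eq_C_mul_expSeries K (a := a + b) (f := expSeries K a * expSeries K b) <| by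
    rw [Derivation.leibniz, derivative_expSeries, derivative_expSeries, hadd, smul_eq_mul,
      smul_eq_mul]
    ring
  rw [h, map_mul, constantCoeff_expSeries, constantCoeff_expSeries, one_mul, map_one, one_mul]

theorem expCoeff_add (a b : ℕ → A) (n : ℕ) :
    expCoeff K (a + b) n = ∑ p ∈ antidiagonal n, expCoeff K a p.1 * expCoeff K b p.2 := by
  simpa only [coeff_mul, coeff_expSeries] using congrArg (coeff n) (expSeries_add K a b)

end Exponential

section Bracket

variable {A : Type*} [CommRing A]

theorem sum_nonempty_pow_card (α : Type*) [Fintype α] (x : A) :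
    ∑ s : Finset α with s.Nonempty, x ^ #s = (1 + x) ^ Fintype.card α - 1 := by
  classical
  have hbinomial := Fintype.sum_pow_mul_eq_add_pow α x 1
  simp only [one_pow, mul_one] at hbinomial
  rw [add_comm, ← hbinomial, ← add_sum_erase _ _ (mem_univ ∅), card_empty, pow_zero,
    add_sub_cancel_left]
  exact sum_congr (by ext s; simp [nonempty_iff_ne_empty]) fun _ _ => rfl

theorem sum_forall_exists_mem_pow_card {ι : Type*} [Fintype ι] [DecidableEq ι] (α : ι → Type*)
    [∀ i, Fintype (α i)] [∀ i, DecidableEq (α i)] (x : A) :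
    ∑ S : Finset (Σ i, α i) with ∀ i, ∃ j, ⟨i, j⟩ ∈ S, x ^ #S =
      ∏ i, ((1 + x) ^ Fintype.card (α i) - 1) := by
  simp only [← sum_nonempty_pow_card, prod_univ_sum]
  let fiber (S : Finset (Σ i, α i)) (i : ι) : Finset (α i) := {j | ⟨i, j⟩ ∈ S}
  have hsigma (S : Finset (Σ i, α i)) : univ.sigma (fiber S) = S := by
    ext ⟨i, j⟩
    simp [fiber]
  have hfiber (p : ∀ i, Finset (α i)) : fiber (univ.sigma p) = p := by
    ext i j
    simp [fiber]
  refine sum_nbij' fiber univ.sigma ?_ ?_ (fun S _ => hsigma S) (fun p _ => hfiber p) fun S _ => ?_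
  · simpa [fiber] using fun S hS i => (hS i).imp fun j hj => by simpa using hj
  · simp only [Fintype.mem_piFinset, mem_filter_univ, mem_sigma, mem_univ, true_and]
    exact fun _ hp => hp
  · rw [prod_pow_eq_pow_sum, ← card_sigma, hsigma]

theorem coeff_prod_one_add_X_pow_sub_one {n : ℕ} (μ : n.Partition) (r : ℕ) :
    (μ.parts.map fun i => (1 + Polynomial.X : Polynomial A) ^ i - 1).prod.coeff r =
      (bracket μ r : A) := by
  have hrows : (μ.parts.map fun i => (1 + Polynomial.X : Polynomial A) ^ i - 1).prod =
      ∏ i, ((1 + Polynomial.X) ^ Fintype.card (Fin ((rows μ).get i)) - 1) := by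
    simp only [Fintype.card_fin]
    rw [← Multiset.sort_eq μ.parts (· ≥ ·), Multiset.map_coe, Multiset.prod_coe,
      ← Fin.prod_univ_fun_getElem]
    rfl
  rw [hrows, ← sum_forall_exists_mem_pow_card, Polynomial.finsetSum_coeff]
  simp only [Polynomial.coeff_X_pow]
  rw [sum_boole, filter_filter, bracket, Fintype.card_subtype]
  congr 2
  ext S
  simp [and_comm, eq_comm]

end Bracket

section PartitionSum

variable (K : Type*) [Field K] {A : Type*} [CommRing A] [Algebra K A]

/-- The paper's `P_{jk}` with the elements `a 1, a 2, …` of a `K`-algebra substituted for the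
indeterminates. -/
noncomputable def partitionSum (a : ℕ → A) (n r : ℕ) : A :=
  ∑ μ : n.Partition, ((bracket μ r : K) / (zee μ : K)) • ∏ i ∈ Icc 1 n, a i ^ mult μ i

theorem neg_one_pow_mul_partitionSum_neg (a : ℕ → A) (n r : ℕ) :
    (-1) ^ r * partitionSum K (-a) n r =
      ∑ μ : n.Partition, ((-1 : K) ^ ((r : ℤ) - (len μ : ℤ)) * ((bracket μ r : K) / (zee μ : K))) •
        ∏ i ∈ Icc 1 n, a i ^ mult μ i := by
  rw [partitionSum, mul_sum]
  refine sum_congr rfl fun μ _ => ?_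
  have hsign : (-1 : K) ^ ((r : ℤ) - (len μ : ℤ)) = (-1) ^ r * (-1) ^ len μ := by
    rw [zpow_sub₀ (neg_ne_zero.2 one_ne_zero), zpow_natCast, zpow_natCast, div_eq_mul_inv,
      ← inv_pow, inv_neg_one]
  have hneg : (μ.parts.map (-a)).prod = (-1) ^ len μ * (μ.parts.map a).prod := by
    rw [len, ← Multiset.card_map a, ← Multiset.prod_map_neg, Multiset.map_map]
    rfl
  rw [prod_pow_mult, prod_pow_mult, hneg, hsign]
  simp only [Algebra.smul_def, map_mul, map_pow, map_neg, map_one]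
  ring

variable [CharZero K]

theorem partitionSum_eq_sum_choose_mul (a : ℕ → A) (n r : ℕ) :
    partitionSum K a n r =
      ∑ p ∈ antidiagonal n, p.1.choose r * (expCoeff K a p.1 * expCoeff K (-a) p.2) := by
  let b : ℕ → Polynomial A := fun i => Polynomial.C (a i)
  have hC (c : ℕ → A) (m : ℕ) :
      expCoeff K (fun i => Polynomial.C (c i)) m = Polynomial.C (expCoeff K c m) :=
    (map_expCoeff K (Polynomial.CAlgHom (R := K)) c m).symm
  have hsum : expCoeff K (fun i => ((1 + Polynomial.X) ^ i - 1) * b i) n =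
      ∑ p ∈ antidiagonal n, (1 + Polynomial.X) ^ p.1 *
        Polynomial.C (expCoeff K a p.1 * expCoeff K (-a) p.2) := by
    have hadd : (fun i => ((1 + Polynomial.X) ^ i - 1) * b i) =
        (fun i => (1 + Polynomial.X) ^ i * b i) + fun i => Polynomial.C ((-a) i) := by
      ext1 i
      simp only [Pi.add_apply, Pi.neg_apply, map_neg, b]
      ring
    rw [hadd, expCoeff_add]
    refine sum_congr rfl fun p _ => ?_
    rw [expCoeff_pow_mul, hC, hC, Polynomial.C_mul, mul_assoc]
  have hcoeff : partitionSum K a n r =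
      (expCoeff K (fun i => ((1 + Polynomial.X) ^ i - 1) * b i) n).coeff r := by
    rw [expCoeff, Polynomial.finsetSum_coeff]
    refine sum_congr rfl fun μ _ => ?_
    have hprod : (μ.parts.map b).prod = Polynomial.C (μ.parts.map a).prod := by
      rw [map_multiset_prod, Multiset.map_map]; rfl
    rw [Multiset.prod_map_mul, hprod, Polynomial.coeff_smul, Polynomial.coeff_mul_C,
      coeff_prod_one_add_X_pow_sub_one, prod_pow_mult, div_eq_inv_mul, mul_smul,
      Nat.cast_smul_eq_nsmul, nsmul_eq_mul]
  rw [hcoeff, hsum, Polynomial.finsetSum_coeff]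
  simp only [Polynomial.coeff_mul_C, Polynomial.coeff_one_add_X_pow]

end PartitionSum

section Binomial

variable {R : Type*} [CommRing R]

theorem binom_eq_choose (K : Type*) [Field K] [CharZero K] [Algebra K R] [BinomialRing R]
    (a : R) (m : ℕ) : binom K a m = Ring.choose a m := by
  have h : ∏ i ∈ range m, (a - (i : R)) = m ! • Ring.choose a m := by
    rw [← Ring.descPochhammer_eq_factorial_smul_choose, ← Polynomial.aeval_eq_smeval,
      Polynomial.aeval_def, Polynomial.eval₂_eq_eval_map, descPochhammer_map,
      descPochhammer_eval_eq_prod_range]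
  rw [binom, h, ← Nat.cast_smul_eq_nsmul K,
    inv_smul_smul₀ (Nat.cast_ne_zero.2 m.factorial_ne_zero)]

variable [BinomialRing R]

theorem multichoose_neg (a : R) (n : ℕ) :
    Ring.multichoose (-a) n = (-1) ^ n * Ring.choose a n := by
  rw [← neg_neg a, Ring.choose_neg', neg_neg, Units.smul_def, zsmul_eq_mul,
    Int.cast_negOnePow_natCast, ← mul_assoc, ← mul_pow, neg_one_mul, neg_neg, one_pow, one_mul]

theorem succ_mul_multichoose_succ (a : R) (n : ℕ) :
    (n + 1) * Ring.multichoose a (n + 1) = a * Ring.multichoose (a + 1) n := by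
  have h := Ring.choose_smul_choose (a + n) n.le_succ
  rw [Nat.succ_eq_add_one, Nat.choose_succ_self_right, Nat.add_sub_cancel_left,
    Ring.choose_one_right, add_sub_cancel_right, nsmul_eq_mul, Nat.cast_succ] at h
  rw [Ring.multichoose_eq, Ring.multichoose_eq, mul_comm a, Nat.cast_succ, ← add_assoc,
    add_sub_cancel_right, add_right_comm, add_sub_cancel_right, h]

theorem multichoose_add (a b : R) (n : ℕ) :
    Ring.multichoose (a + b) n =
      ∑ p ∈ antidiagonal n, Ring.multichoose a p.1 * Ring.multichoose b p.2 := by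
  have hneg (c : R) (m : ℕ) : Ring.multichoose c m = (-1) ^ m * Ring.choose (-c) m := by
    rw [← multichoose_neg, neg_neg]
  rw [hneg, neg_add, Ring.add_choose_eq n (Commute.all _ _), mul_sum]
  refine sum_congr rfl fun p hp => ?_
  rw [hneg, hneg, ← mem_antidiagonal.1 hp, pow_add]
  ring

theorem choose_mul_multichoose_add (a : R) (m r : ℕ) :
    (r + m).choose r * Ring.multichoose a (r + m) =
      Ring.multichoose a r * Ring.multichoose (a + r) m := by
  have h := Ring.choose_smul_choose (a + (r + m : ℕ) - 1) (Nat.le_add_left m r)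
  rw [nsmul_eq_mul, Nat.add_sub_cancel, ← Nat.choose_symm_add] at h
  rw [Ring.multichoose_eq, h, Ring.multichoose_eq, Ring.multichoose_eq, mul_comm]
  congr 2 <;> (push_cast; ring)

theorem sum_choose_mul_multichoose_mul_multichoose (a b : R) (n r : ℕ) :
    ∑ p ∈ antidiagonal n, p.1.choose r * (Ring.multichoose a p.1 * Ring.multichoose b p.2) =
      if r ≤ n then Ring.multichoose a r * Ring.multichoose (a + b + r) (n - r) else 0 := by
  have hsupp (p : ℕ × ℕ)
      (hp : p.1.choose r * (Ring.multichoose a p.1 * Ring.multichoose b p.2) ≠ 0) : r ≤ p.1 := by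
    by_contra h
    rw [Nat.choose_eq_zero_of_lt (not_le.1 h), Nat.cast_zero, zero_mul] at hp
    exact hp rfl
  rw [← sum_filter_of_ne fun p _ => hsupp p]
  split_ifs with hrn
  · rw [Nat.antidiagonal_filter_le_fst_of_le hrn, sum_map, add_right_comm, multichoose_add, mul_sum]
    refine sum_congr rfl fun p _ => ?_
    change ((p.1 + r).choose r : R) * (Ring.multichoose a (p.1 + r) * Ring.multichoose b p.2) = _
    rw [add_comm p.1 r, ← mul_assoc, choose_mul_multichoose_add, mul_assoc]
  · refine sum_eq_zero fun p hp => absurd ?_ hrn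
    obtain ⟨hpn, hrp⟩ := mem_filter.1 hp
    exact hrp.trans ((Nat.le_add_right _ _).trans_eq (mem_antidiagonal.1 hpn))

theorem multichoose_natCast (k n : ℕ) : Ring.multichoose (k : R) n = k.multichoose n := by
  cases k with
  | zero => cases n <;> simp
  | succ k =>
    rw [Ring.multichoose_eq, Nat.multichoose_eq, Nat.cast_succ, add_right_comm,
      add_sub_cancel_right, ← Nat.cast_add, Ring.choose_natCast, add_right_comm, Nat.add_sub_cancel]

theorem multichoose_succ_comm (k n : ℕ) : (k + 1).multichoose n = (n + 1).multichoose k := by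
  rw [Nat.multichoose_eq, Nat.multichoose_eq, add_right_comm, Nat.add_sub_cancel, add_right_comm,
    Nat.add_sub_cancel, add_comm n, Nat.choose_symm_add]

end Binomial

section RisingSeries

open PowerSeries

variable {R : Type*} [CommRing R]

/-- The series `∑ k, (i)_k / k! * x k * u ^ k` in `u`; note that `(i)_k / k!` is the integer
`Nat.multichoose i k`.  The paper's `z` is `x 0`. -/
noncomputable def risingSeries (x : ℕ → R) (i : ℕ) : R⟦X⟧ :=
  mk fun k => (i.multichoose k : R) * x k

theorem risingSeries_neg (x : ℕ → R) : risingSeries (-x) = -risingSeries x := by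
  ext i k
  simp [risingSeries]

variable (K : Type*) [Field K] [CharZero K] [Algebra K R]

theorem add_natCast_mul_expCoeff (x : ℕ → R) (j : ℕ) :
    (x 0 + j) * expCoeff K x j = ∑ p ∈ antidiagonal j, x p.1 * expCoeff K x p.2 := by
  cases j with
  | zero => simp
  | succ j =>
    rw [Nat.sum_antidiagonal_succ, ← succ_mul_expCoeff_succ, add_mul, Nat.cast_succ]

variable [BinomialRing R]

/-- The coefficient of `q ^ n` in `∑ j, u ^ j * h_j * (1 - q) ^ (-(x 0 + j))`, where `h_j` is
`expCoeff K x j`; as a series in `q` it solves the differential equation of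
`expSeries K (risingSeries x)`. -/
noncomputable def shiftedSeries (x : ℕ → R) (n : ℕ) : R⟦X⟧ :=
  mk fun j => expCoeff K x j * Ring.multichoose (x 0 + j) n

theorem derivative_shiftedSeries (x : ℕ → R) :
    d⁄dX R⟦X⟧ (mk (shiftedSeries K x)) =
      mk (fun i => risingSeries x (i + 1)) * mk (shiftedSeries K x) := by
  ext n j
  have habsorb : coeff j (coeff n (d⁄dX R⟦X⟧ (mk (shiftedSeries K x)))) =
      (x 0 + j) * expCoeff K x j * Ring.multichoose (x 0 + j + 1) n := by
    rw [coeff_derivative, coeff_mk, mul_comm, ← Nat.cast_succ, ← nsmul_eq_mul, map_nsmul,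
      shiftedSeries, coeff_mk, nsmul_eq_mul, Nat.cast_succ, mul_left_comm,
      succ_mul_multichoose_succ]
    ring
  rw [habsorb, add_natCast_mul_expCoeff, sum_mul, coeff_mul, map_sum]
  simp only [coeff_mk, coeff_mul, shiftedSeries, risingSeries]
  rw [sum_comm]
  refine sum_congr rfl fun p hp => ?_
  have hj : x 0 + j + 1 = ((p.1 : R) + 1) + (x 0 + p.2) := by
    rw [← mem_antidiagonal.1 hp, Nat.cast_add]
    ring
  rw [hj, multichoose_add, mul_sum]
  refine sum_congr rfl fun q _ => ?_
  rw [← Nat.cast_succ, multichoose_natCast, Nat.succ_eq_add_one, multichoose_succ_comm]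
  ring

theorem expSeries_mul_expCoeff_risingSeries (x : ℕ → R) (n : ℕ) :
    expSeries K x * expCoeff K (risingSeries x) n = shiftedSeries K x n := by
  have h := congrArg (coeff n) (eq_C_mul_expSeries K (derivative_shiftedSeries K x))
  have h0 : shiftedSeries K x 0 = expSeries K x := by
    simp only [shiftedSeries, Ring.multichoose_zero_right, mul_one]
    rfl
  rw [coeff_C_mul, coeff_mk, ← coeff_zero_eq_constantCoeff_apply, coeff_mk, h0,
    coeff_expSeries] at h
  exact h.symm

theorem expCoeff_neg_mul_expCoeff_risingSeries (x : ℕ → R) (m n : ℕ) :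
    expCoeff K (-risingSeries x) m * expCoeff K (risingSeries x) n =
      shiftedSeries K (-x) m * shiftedSeries K x n := by
  rw [← expSeries_mul_expCoeff_risingSeries, ← expSeries_mul_expCoeff_risingSeries,
    risingSeries_neg, mul_mul_mul_comm, mul_comm (expSeries K (-x)), expSeries_mul_expSeries_neg,
    one_mul]

theorem coeff_partitionSum_neg_risingSeries (x : ℕ → R) (n r j : ℕ) :
    coeff j (partitionSum K (-risingSeries x) n r) =
      natBinom (n + j - 1) n r * ((-1) ^ r * ∑ p ∈ antidiagonal j,
        expCoeff K x p.1 * expCoeff K (-x) p.2 * Ring.choose (x 0 - p.2) r) := by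
  have hterm (p : ℕ × ℕ) : coeff j ((p.1.choose r : R⟦X⟧) *
      (expCoeff K (-risingSeries x) p.1 * expCoeff K (risingSeries x) p.2)) =
      ∑ q ∈ antidiagonal j, expCoeff K x q.1 * expCoeff K (-x) q.2 * (p.1.choose r *
        (Ring.multichoose (-(x 0 - q.2)) p.1 * Ring.multichoose (x 0 + q.1) p.2)) := by
    rw [expCoeff_neg_mul_expCoeff_risingSeries, ← nsmul_eq_mul, map_nsmul, coeff_mul, nsmul_eq_mul,
      mul_sum, ← Nat.sum_antidiagonal_swap]
    simp only [shiftedSeries, coeff_mk, Pi.neg_apply, Prod.fst_swap, Prod.snd_swap]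
    exact sum_congr rfl fun q _ => by rw [neg_sub, sub_eq_neg_add]; ring
  rw [partitionSum_eq_sum_choose_mul, neg_neg, map_sum, sum_congr rfl fun p _ => hterm p, sum_comm,
    mul_sum, mul_sum]
  refine sum_congr rfl fun q hq => ?_
  rw [← mul_sum, sum_choose_mul_multichoose_mul_multichoose, natBinom]
  split_ifs with hrn
  · have hj : -(x 0 - q.2) + (x 0 + q.1) + r = ((j + r : ℕ) : R) := by
      rw [← mem_antidiagonal.1 hq]
      push_cast
      ring
    have hnj : j + r + (n - r) - 1 = n + j - 1 := by lia
    rw [hj, multichoose_natCast, Nat.multichoose_eq, hnj, multichoose_neg]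
    ring
  · ring

theorem sum_choose_mul_partitionSum (x : ℕ → R) (z : R) (r j : ℕ) :
    ∑ k ∈ range (min r j + 1), Ring.choose (z - j) (r - k) * partitionSum K x j k =
      ∑ p ∈ antidiagonal j, expCoeff K x p.1 * expCoeff K (-x) p.2 * Ring.choose (z - p.2) r := by
  simp only [partitionSum_eq_sum_choose_mul, mul_sum]
  rw [sum_comm]
  refine sum_congr rfl fun p hp => ?_
  have hpj := mem_antidiagonal.1 hp
  have hz : z - p.2 = p.1 + (z - j) := by
    rw [← hpj, Nat.cast_add]
    ring
  have hrange : range (min r j + 1) ⊆ range (r + 1) := range_mono (by lia)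
  rw [hz, Ring.add_choose_eq r (Commute.all _ _), mul_sum,
    Nat.sum_antidiagonal_eq_sum_range_succ_mk]
  refine sum_subset_zero_on_sdiff hrange (fun k hk => ?_) fun k _ => ?_
  · rw [Ring.choose_natCast, Nat.choose_eq_zero_of_lt, Nat.cast_zero, zero_mul, mul_zero]
    simp only [mem_sdiff, mem_range] at hk
    lia
  · rw [Ring.choose_natCast]
    ring

theorem partitionSum_neg_risingSeries (x : ℕ → R) (n r : ℕ) :
    (-1) ^ r * partitionSum K (-risingSeries x) n r =
      mk fun j => natBinom (n + j - 1) n r *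
        ∑ k ∈ range (min r j + 1), binom K (x 0 - j) (r - k) * partitionSum K x j k := by
  ext j
  have hsign : ((-1) ^ r : R⟦X⟧) = C ((-1) ^ r) := by simp
  simp only [binom_eq_choose]
  rw [hsign, coeff_C_mul, coeff_partitionSum_neg_risingSeries, coeff_mk,
    sum_choose_mul_partitionSum, mul_left_comm, ← mul_assoc ((-1) ^ r), ← mul_pow, neg_one_mul,
    neg_neg, one_pow, one_mul]

end RisingSeries

section Indeterminates

/-- The sequence `z, X_1, X_2, …` of indeterminates, in the indexing of `risingSeries`. -/
noncomputable def indets (K : Type*) [Field K] : ℕ → Coeff K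
  | 0 => zVar K
  | k + 1 => xVar K (k + 1)

theorem risingSeries_indets (K : Type*) [Field K] [CharZero K] (i : ℕ) :
    risingSeries (indets K) i = rowSeries K i := by
  ext1 k
  have hmultichoose : (i.multichoose k : K) = i.ascFactorial k / k ! := by
    rw [Nat.ascFactorial_eq_factorial_mul_choose', Nat.cast_mul,
      mul_div_cancel_left₀ _ (Nat.cast_ne_zero.2 k.factorial_ne_zero), Nat.multichoose_eq]
  rw [rowSeries, map_add, risingSeries, PowerSeries.coeff_mk, PowerSeries.coeff_mk,
    ← nsmul_eq_mul, ← Nat.cast_smul_eq_nsmul K, hmultichoose]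
  cases k <;> simp [indets]

theorem partitionSum_indets (K : Type*) [Field K] (j k : ℕ) :
    partitionSum K (indets K) j k = Polynomial.C (P K j k) := by
  rw [partitionSum, P, map_sum]
  refine sum_congr rfl fun μ _ => ?_
  rw [← Polynomial.smul_C, map_prod]
  refine congrArg _ (prod_congr rfl fun i hi => ?_)
  obtain ⟨i, rfl⟩ := Nat.exists_eq_add_of_le' (mem_Icc.1 hi).1
  rw [indets, map_pow, xVar]

end Indeterminates

end PartitionIdentity

open PartitionIdentity in
theorem mainTheorem1_general (K : Type*) [Field K] [CharZero K] {R : Type*} [CommRing R]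
    [Algebra K R] (x : ℕ → R) (n r : ℕ) :
    ∑ μ : n.Partition, ((-1 : K) ^ ((r : ℤ) - (len μ : ℤ)) * ((bracket μ r : K) / (zee μ : K))) •
        ∏ i ∈ Finset.Icc 1 n, risingSeries x i ^ mult μ i =
      PowerSeries.mk fun j => natBinom (n + j - 1) n r *
        ∑ k ∈ Finset.range (min r j + 1), binom K (x 0 - j) (r - k) * partitionSum K x j k := by
  -- Over `ℚ≥0`, `R` is a binomial ring, so that `Ring.choose` and `Ring.multichoose` apply.
  let : Module ℚ≥0 R := Module.compHom R (algebraMap ℚ≥0 K)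
  rw [← partitionSum_neg_risingSeries, neg_one_pow_mul_partitionSum_neg]

theorem mainTheorem1 (K : Type*) [Field K] [CharZero K] (n r : ℕ) (hn : 1 ≤ n) (hr : 1 ≤ r) :
    (∑ μ : n.Partition,
      ((-1 : K) ^ ((r : ℤ) - (PartitionIdentity.len μ : ℤ)) *
          ((PartitionIdentity.bracket μ r : K) / (PartitionIdentity.zee μ : K))) •
        ∏ i ∈ Finset.Icc 1 n,
          PartitionIdentity.rowSeries K i ^ PartitionIdentity.mult μ i) =
    PowerSeries.mk fun j : ℕ =>
      (PartitionIdentity.natBinom (n + j - 1) n r : PartitionIdentity.Coeff K) *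
        ∑ k ∈ Finset.range (min r j + 1),
          PartitionIdentity.binom K
              (PartitionIdentity.zVar K - (j : PartitionIdentity.Coeff K)) (r - k) *
            Polynomial.C (PartitionIdentity.P K j k) := by
  simpa only [PartitionIdentity.risingSeries_indets, PartitionIdentity.partitionSum_indets,
    PartitionIdentity.indets] using
    mainTheorem1_general K (PartitionIdentity.indets K) n r
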